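/- Let $V$ be a finite-dimensional real vector space with its usual topology, and let $(V,\circ,e)$ be a Euclidean Jordan algebra with identity: $\circ$ is bilinear and commutative, $x\circ(x^2\circ y)=x^2\circ(x\circ y)$, $x\circ e=x$, and $V$ carries an associative positive definite bilinear form. Let $r$ be its rank, i.e. the smallest integer such that $e,x,\dots,x^r$ are linearly dependent for every $x\in V$. Each $x\in V$ has a spectral decomposition $x=\sum_{i=1}^r\lambda_i(x)c_i$, where $c_1,\dots,c_r$ is a Jordan frame (non-zero primitive idempotents with $c_i\circ c_j=0$ for $i\ne j$ and $\sum_i c_i=e$). Put $\langle x,y\rangle=\operatorname{trace}(x\circ y)$ with $\operatorname{trace}(x)=\sum_i\lambda_i(x)$, $\|x\|_F=\sqrt{\langle x,x\rangle}$ and $\|x\|=\max_i|\lambda_i(x)|$. Let $\Omega$ be the interior of the cone of squares $\{x^2:x\in V\}$, let $v^+$ be the point of $\overline\Omega$ nearest to $v$ in $\|\cdot\|_F$, and let $\Delta(\Omega)=\{x\in\overline\Omega:\langle e,x\rangle=1\}$. Let $P:V\to V$ be the orthogonal projection onto a linear subspace $L\subseteq V$ with respect to $\langle\cdot,\cdot\rangle$.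 The perceptron scheme starts with any $z_0\in\Delta(\Omega)$ and, for $t=0,1,2,\dots$, as long as the stopping condition is not satisfied by $z_t$, picks any $u\in\Delta(\Omega)$ with $\langle u,Pz_t\rangle\le 0$ and sets $z_{t+1}=\frac{t}{t+1}z_t+\frac1{t+1}u$. (1) With the stopping condition "$Pz\in\Omega$ or $\|(Pz)^+\|_F\le\frac1{4r}\|z\|$", for every such choice of $z_0$ and of the vectors $u$, the stopping condition is satisfied by $z_t$ for some $t\le(4r^2)^2=16r^4$. (2) In the special case of the non-negative orthant, that is, $V=\mathbb R^n$ with the standard inner product, $\Delta=\{x\in\mathbb R^n: x\ge0,\ \sum_i x_i=1\}$ in place of $\Delta(\Omega)$, $P$ the orthogonal projection onto a linear subspace of $\mathbb R^n$, and $v^+=\max(v,0)$ componentwise, and with the stopping condition "$Pz>0$ (componentwise) or $\|(Pz)^+\|_2\le\frac1{3\sqrt n}\|z\|_\infty$", for every such choice of $z_0$ and of the vectors $u$, the stopping condition is satisfied by $z_t$ for some $t\le(3n\sqrt n)^2=9n^3$. -/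

import Mathlib

/-- A Euclidean Jordan algebra with identity `(V, ∘, e)` on a real vector space `V`
(finite-dimensionality of `V` is assumed where the structure is used). -/
structure EuclideanJordanAlgebra (V : Type*) [AddCommGroup V] [Module ℝ V] where
  /-- the bilinear product `x ∘ y` -/
  mul : V →ₗ[ℝ] V →ₗ[ℝ] V
  /-- the identity element -/
  e : V
  mul_comm : ∀ x y, mul x y = mul y x
  jordan : ∀ x y, mul x (mul (mul x x) y) = mul (mul x x) (mul x y)
  mul_e : ∀ x, mul x e = x
  /-- there is an associative positive definite bilinear form -/
  exists_form : ∃ B : V →ₗ[ℝ] V →ₗ[ℝ] ℝ,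
    (∀ x y z, B (mul x y) z = B x (mul y z)) ∧ ∀ x, x ≠ 0 → 0 < B x x

namespace EuclideanJordanAlgebra

noncomputable section

section Algebra

variable {V : Type*} [AddCommGroup V] [Module ℝ V] (J : EuclideanJordanAlgebra V)

/-- Powers `x ^ k` for the Jordan product, with `x ^ 0 = e`. -/
def pow (x : V) : ℕ → V
  | 0 => J.e
  | k + 1 => J.mul x (pow x k)

/-- The rank: the smallest `r` such that `e, x, …, x ^ r` are linearly dependent for all `x`. -/
def rank : ℕ :=
  sInf {r : ℕ | ∀ x : V, ¬ LinearIndependent ℝ (fun i : Fin (r + 1) => J.pow x i)}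

def IsIdempotent (c : V) : Prop := J.mul c c = c

/-- An idempotent that is not the sum of two other idempotents. -/
def IsPrimitiveIdempotent (c : V) : Prop :=
  J.IsIdempotent c ∧
    ¬ ∃ a b : V, J.IsIdempotent a ∧ J.IsIdempotent b ∧ a ≠ c ∧ b ≠ c ∧ c = a + b

/-- `c₁, …, c_r` (with `r` the rank) are non-zero primitive idempotents with `c_i ∘ c_j = 0`
for `i ≠ j` and `c₁ + ⋯ + c_r = e`. -/
def IsJordanFrame (c : Fin J.rank → V) : Prop :=
  (∀ i, c i ≠ 0 ∧ J.IsPrimitiveIdempotent (c i)) ∧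
    (∀ i j, i ≠ j → J.mul (c i) (c j) = 0) ∧ ∑ i, c i = J.e

/-- `x = ∑ i, l i • c i` for some Jordan frame `c`. -/
def IsEigenvalueVector (x : V) (l : Fin J.rank → ℝ) : Prop :=
  ∃ c : Fin J.rank → V, J.IsJordanFrame c ∧ x = ∑ i, l i • c i

/-- The vector of eigenvalues of `x`, i.e. the coefficients of a spectral decomposition of `x`
(they are determined by `x` up to their order, which plays no role below). -/
def eigenvalues (x : V) : Fin J.rank → ℝ :=
  Classical.epsilon (J.IsEigenvalueVector x)

def trace (x : V) : ℝ := ∑ i, J.eigenvalues x i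

/-- The trace inner product. -/
def ip (x y : V) : ℝ := J.trace (J.mul x y)

/-- The Frobenius norm. -/
def frobNorm (x : V) : ℝ := Real.sqrt (J.ip x x)

/-- The operator norm: the largest absolute value of an eigenvalue
(the norm on `Fin J.rank → ℝ` is the maximum norm). -/
def opNorm (x : V) : ℝ := ‖J.eigenvalues x‖

/-- `P` is the orthogonal projection onto the subspace `L` for the trace inner product. -/
def IsOrthogonalProjection (L : Submodule ℝ V) (P : V → V) : Prop :=
  ∀ x, P x ∈ L ∧ ∀ y ∈ L, J.ip (x - P x) y = 0

end Algebra

section Cone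

variable {V : Type*} [AddCommGroup V] [Module ℝ V] [TopologicalSpace V]
  (J : EuclideanJordanAlgebra V)

/-- The interior of the cone of squares. -/
def Omega : Set V := interior {x : V | ∃ y : V, x = J.mul y y}

/-- The spectraplex `{x ∈ closure Ω : ⟨e, x⟩ = 1}`. -/
def spectraplex : Set V := {x : V | x ∈ closure J.Omega ∧ J.ip J.e x = 1}

/-- `v⁺`: the point of `closure Ω` nearest to `v` in the Frobenius norm. -/
def posPart (v : V) : V :=
  haveI : Nonempty V := ⟨0⟩
  Classical.epsilon fun p : V =>
    p ∈ closure J.Omega ∧ ∀ q ∈ closure J.Omega, J.frobNorm (v - p) ≤ J.frobNorm (v - q)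

/-- One of the stopping conditions `P z ∈ Ω`, `‖(P z)⁺‖_F ≤ ‖z‖ / (4 r)` holds at `z`. -/
def Stop (P : V → V) (z : V) : Prop :=
  P z ∈ J.Omega ∨ J.frobNorm (J.posPart (P z)) ≤ 1 / (4 * (J.rank : ℝ)) * J.opNorm z

end Cone

end

end EuclideanJordanAlgebra

/-- `z 0, z 1, …` are iterates of the perceptron scheme over the spectraplex `D`, with inner
product `ip`, projection `P` and stopping condition `Stop`: as long as the scheme has not halted,
some `u ∈ D` with `⟨u, P z_t⟩ ≤ 0` is picked and `z_{t+1} = t/(t+1) z_t + 1/(t+1) u`. Nothing is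
required of the sequence after the scheme has halted. -/
def IsPerceptronRun {V : Type*} [AddCommGroup V] [Module ℝ V] (D : Set V) (ip : V → V → ℝ)
    (P : V → V) (Stop : V → Prop) (z : ℕ → V) : Prop :=
  z 0 ∈ D ∧
    ∀ t : ℕ, (∀ s ≤ t, ¬ Stop (z s)) →
      ∃ u ∈ D, ip u (P (z t)) ≤ 0 ∧
        z (t + 1) = ((t : ℝ) / ((t : ℝ) + 1)) • z t + (1 / ((t : ℝ) + 1)) • u

/-- The spectraplex of the orthant: the standard simplex. -/
def orthantSpectraplex (n : ℕ) : Set (EuclideanSpace ℝ (Fin n)) :=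
  {x | (∀ i, 0 ≤ x i) ∧ ∑ i, x i = 1}

/-- The componentwise positive part. -/
noncomputable def orthantPosPart {n : ℕ} (v : EuclideanSpace ℝ (Fin n)) :
    EuclideanSpace ℝ (Fin n) :=
  WithLp.toLp 2 (fun i => max (v i) 0)

/-- One of the stopping conditions `P z > 0`, `‖(P z)⁺‖₂ ≤ ‖z‖_∞ / (3 √n)` holds at `z`
(the norm of `WithLp.ofLp z : Fin n → ℝ` is the maximum norm). -/
def OrthantStop {n : ℕ} (P : EuclideanSpace ℝ (Fin n) → EuclideanSpace ℝ (Fin n))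
    (z : EuclideanSpace ℝ (Fin n)) : Prop :=
  (∀ i, 0 < P z i) ∨
    ‖orthantPosPart (P z)‖ ≤ 1 / (3 * Real.sqrt (n : ℝ)) * ‖WithLp.ofLp z‖

/-! The bound is the perceptron estimate. Points `u` of the spectraplex satisfy `‖u‖_F ≤ 1`, and
`⟨u, P z_t⟩ ≤ 0` removes the cross term when `(t + 1) P z_{t+1} = t P z_t + P u` is squared, so `t
‖P z_t‖² ≤ 1` by induction (`IsPerceptronRun.bound`). Trace one forces `‖z_t‖ ≥ 1/r`. If the scheme
has not stopped by `T = 16 r⁴`, then `‖P z_T‖_F ≥ ‖(P z_T)⁺‖_F > ‖z_T‖ / (4r) ≥ 1 / (4r²)`,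
contradicting `T ‖P z_T‖² ≤ 1`. The orthant is the same argument with `1 / (3 n √n)`.

Most of the work is to justify this for the trace defined by chosen eigenvalues. The spectral
theorem (`IsIdempotent.exists_spectral`) comes from Peirce theory; `exists_linear_trace` gives a
linear functional equal to `1` on non-zero primitive idempotents, whence frames have `r` elements
(`card_eq_rank`) and the trace form is bilinear and positive definite (`exists_trace_form`). -/

/-! ### Positive definite forms and symmetric operators. -/

/-- A positive definite symmetric bilinear form on a finite-dimensional real space is the pullback
of a Euclidean inner product along a linear equivalence. -/
lemma exists_equiv_euclideanSpace {W : Type*} [AddCommGroup W] [Module ℝ W]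
    [FiniteDimensional ℝ W] (B : W →ₗ[ℝ] W →ₗ[ℝ] ℝ) (hs : ∀ x y, B x y = B y x)
    (hp : ∀ x, x ≠ 0 → 0 < B x x) :
    ∃ (n : ℕ) (Φ : W ≃ₗ[ℝ] EuclideanSpace ℝ (Fin n)), ∀ x y, B x y = inner ℝ (Φ x) (Φ y) := by
  let core : InnerProductSpace.Core ℝ W :=
    { inner := fun x y => B x y
      conj_inner_symm := fun x y => by simpa using hs y x
      re_inner_nonneg := fun x => by
        by_cases h : x = 0
        · simp [h]
        · simpa using (hp x h).le
      add_left := fun x y z => by simp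
      smul_left := fun x y r => by simp
      definite := fun x h => by
        by_contra h0
        exact (hp x h0).ne' h }
  let _ : NormedAddCommGroup W := core.toNormedAddCommGroup
  let _ : InnerProductSpace ℝ W := InnerProductSpace.ofCore core.toCore
  let b := stdOrthonormalBasis ℝ W
  refine ⟨_, b.repr.toLinearEquiv, fun x y => ?_⟩
  have h := b.repr.inner_map_map x y
  exact h.symm

/-- A linear map that is symmetric for a positive definite form has an eigenvector. -/
lemma exists_eigenvector_of_symmetric {W : Type*} [AddCommGroup W] [Module ℝ W]
    [FiniteDimensional ℝ W] [Nontrivial W] (B : W →ₗ[ℝ] W →ₗ[ℝ] ℝ) (hs : ∀ x y, B x y = B y x)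
    (hp : ∀ x, x ≠ 0 → 0 < B x x) (T : W →ₗ[ℝ] W) (hT : ∀ x y, B (T x) y = B x (T y)) :
    ∃ (a : ℝ) (w : W), w ≠ 0 ∧ T w = a • w := by
  obtain ⟨n, Φ, hΦ⟩ := exists_equiv_euclideanSpace B hs hp
  have : Nontrivial (EuclideanSpace ℝ (Fin n)) := Φ.symm.toEquiv.nontrivial
  let S : EuclideanSpace ℝ (Fin n) →ₗ[ℝ] EuclideanSpace ℝ (Fin n) :=
    Φ.toLinearMap ∘ₗ T ∘ₗ Φ.symm.toLinearMap
  have hS : S.IsSymmetric := fun x y => by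
    have := hT (Φ.symm x) (Φ.symm y)
    rw [hΦ, hΦ] at this
    simpa [S] using this
  obtain ⟨w, hw⟩ := hS.hasEigenvalue_iSup_of_finiteDimensional.exists_hasEigenvector
  have h := congrArg Φ.symm hw.apply_eq_smul
  rw [map_smul] at h
  exact ⟨_, Φ.symm w, by simpa using hw.2, by simpa [S] using h⟩

/-! ### Jordan identities and Peirce spaces of an idempotent. -/

namespace EuclideanJordanAlgebra

variable {V : Type*} [AddCommGroup V] [Module ℝ V] (J : EuclideanJordanAlgebra V)

lemma exists_symm_form : ∃ B : V →ₗ[ℝ] V →ₗ[ℝ] ℝ,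
    (∀ x y z, B (J.mul x y) z = B x (J.mul y z)) ∧ (∀ x, x ≠ 0 → 0 < B x x) ∧
      (∀ x y, B x y = B y x) ∧ ∀ x y, B (J.mul x y) J.e = B x y := by
  obtain ⟨B, h1, h2⟩ := J.exists_form
  have h3 : ∀ x y, B (J.mul x y) J.e = B x y := fun x y => by rw [h1, J.mul_e]
  exact ⟨B, h1, h2, fun x y => by rw [← h3, J.mul_comm, h3], h3⟩

/-- The linearized Jordan identity. -/
lemma jordan_linearized (x y z : V) :
    J.mul z (J.mul (J.mul x x) y) + (2 : ℝ) • J.mul x (J.mul (J.mul x z) y) =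
      J.mul (J.mul x x) (J.mul z y) + (2 : ℝ) • J.mul (J.mul x z) (J.mul x y) := by
  have h1 := J.jordan (x + z) y
  have h2 := J.jordan (x - z) y
  have h3 := J.jordan z y
  simp only [map_add, map_sub, LinearMap.add_apply, LinearMap.sub_apply, J.mul_comm z x]
    at h1 h2
  -- The odd part in `z` of the cubic identity consists of a linear and a cubic term; `h3` removes
  -- the cubic one.
  linear_combination (norm := module) (1 / 2 : ℝ) • h1 - (1 / 2 : ℝ) • h2 - h3

/-- The linearized identity read as an identity of operators acting on `z`. -/
lemma mul_sq_mul (x y : V) :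
    J.mul (J.mul (J.mul x x) y) = J.mul (J.mul x x) * J.mul y
      - (2 : ℝ) • (J.mul x * (J.mul y * J.mul x)) + (2 : ℝ) • (J.mul (J.mul x y) * J.mul x) := by
  ext z
  have h := J.jordan_linearized x y z
  simp only [LinearMap.add_apply, LinearMap.sub_apply, LinearMap.smul_apply, Module.End.mul_apply]
  rw [J.mul_comm _ z, J.mul_comm y z, J.mul_comm y (J.mul x z), J.mul_comm (J.mul x y) (J.mul x z)]
  linear_combination (norm := module) h

lemma commute_mul_sq (x : V) : Commute (J.mul x) (J.mul (J.mul x x)) := by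
  ext y
  exact J.jordan x y

/-- The induction step by which multiplication by `x` commutes with multiplication by its powers. -/
lemma commute_mul_sq_mul {x y : V} (h1 : Commute (J.mul x) (J.mul y))
    (h2 : Commute (J.mul x) (J.mul (J.mul x y))) :
    Commute (J.mul x) (J.mul (J.mul (J.mul x x) y)) := by
  rw [mul_sq_mul]
  have h0 := J.commute_mul_sq x
  have hr := Commute.refl (J.mul x)
  exact ((h0.mul_right h1).sub_right ((hr.mul_right (h1.mul_right hr)).smul_right _)).add_right
    ((h2.mul_right hr).smul_right _)

section Peirce

variable {J} {c : V}

/-- With `T = J.mul c`, `mul_sq_mul` at `c, c` reads `2T³ - 3T² + T = 0`, so `2T² - T` maps into the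
Peirce `1`-space. -/
lemma IsIdempotent.peirce (hc : J.IsIdempotent c) (x : V) :
    J.mul c ((2 : ℝ) • J.mul c (J.mul c x) - J.mul c x) =
      (2 : ℝ) • J.mul c (J.mul c x) - J.mul c x := by
  have h := LinearMap.congr_fun (J.mul_sq_mul c c) x
  have hc' : J.mul c c = c := hc
  simp only [hc', LinearMap.add_apply, LinearMap.sub_apply, LinearMap.smul_apply,
    Module.End.mul_apply] at h
  rw [map_sub, map_smul]
  linear_combination (norm := module) h

lemma IsIdempotent.commute_of_one (hc : J.IsIdempotent c) {z : V} (hz : J.mul c z = z) (y : V) :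
    J.mul c (J.mul z y) = J.mul z (J.mul c y) := by
  have h := J.jordan_linearized c y z
  have hc' : J.mul c c = c := hc
  rw [hc', hz] at h
  linear_combination (norm := module) h

lemma IsIdempotent.commute_of_zero (hc : J.IsIdempotent c) {z : V} (hz : J.mul c z = 0) (y : V) :
    J.mul c (J.mul z y) = J.mul z (J.mul c y) := by
  have h := J.jordan_linearized c y z
  have hc' : J.mul c c = c := hc
  simpa [hc', hz] using h.symm

/-- Multiplication by `c` commutes with that by `z` and by `w`, so it both fixes and kills `z ∘ w`.
-/
lemma IsIdempotent.mul_eq_zero (hc : J.IsIdempotent c) {z w : V} (hz : J.mul c z = 0)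
    (hw : J.mul c w = w) : J.mul z w = 0 := by
  have h1 := hc.commute_of_zero hz w
  have h2 := hc.commute_of_one hw z
  rw [hw] at h1
  rw [hz, J.mul_comm w z, h1, map_zero] at h2
  exact h2

lemma IsIdempotent.sub {d : V} (hc : J.IsIdempotent c) (hd : J.IsIdempotent d)
    (hcd : J.mul c d = d) : J.IsIdempotent (c - d) := by
  have hc' : J.mul c c = c := hc
  have hd' : J.mul d d = d := hd
  simp [IsIdempotent, hc', hd', hcd, J.mul_comm d c]

/-- The Peirce `1`-space is monotone in the idempotent. -/
lemma IsIdempotent.mul_eq_of_le {d : V} (hd : J.IsIdempotent d) (hcd : J.mul c d = d) {y : V}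
    (hy : J.mul d y = y) : J.mul c y = y := by
  have hd' : J.mul d d = d := hd
  have h : J.mul d (c - d) = 0 := by rw [map_sub, hd', J.mul_comm, hcd, sub_self]
  have := hd.mul_eq_zero h hy
  rw [map_sub, LinearMap.sub_apply, hy, sub_eq_zero] at this
  exact this

end Peirce

/-! ### The spectral theorem. -/

section Spectral

variable [FiniteDimensional ℝ V] {J} {c : V}

/-- An element of the Peirce `1`-space of `c` that is not a multiple of `c` splits off an
idempotent. -/
lemma IsIdempotent.exists_idempotent (hc : J.IsIdempotent c) {x : V} (hx : J.mul c x = x)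
    (hxc : ∀ a : ℝ, x ≠ a • c) :
    ∃ d, J.IsIdempotent d ∧ d ≠ 0 ∧ d ≠ c ∧ J.mul c d = d ∧ ∃ a : ℝ, J.mul x d = a • d := by
  obtain ⟨B, hB, hpos, hsymm, hBe⟩ := J.exists_symm_form
  have hc' : J.mul c c = c := hc
  -- Powers of `x` in the Peirce `1`-space of `c`, where `c` is the unit.
  let y : ℕ → V := fun k => ((J.mul x) ^ k) c
  have y0 : y 0 = c := rfl
  have ys : ∀ k, y (k + 1) = J.mul x (y k) := fun k => by
    simp only [y, pow_succ', Module.End.mul_apply]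
  have y1 : y 1 = x := by rw [ys, y0, J.mul_comm, hx]
  have hxcomm : Commute (J.mul x) (J.mul c) := by
    ext z
    exact (hc.commute_of_one hx z).symm
  have hcomm : ∀ k, Commute (J.mul x) (J.mul (y k)) ∧ Commute (J.mul x) (J.mul (y (k + 1))) := by
    intro k
    induction k with
    | zero => rw [zero_add, y1, y0]; exact ⟨hxcomm, Commute.refl _⟩
    | succ k ih =>
      refine ⟨ih.2, ?_⟩
      have h : y (k + 1 + 1) = J.mul (J.mul x x) (y k) := by
        have := LinearMap.congr_fun ih.1.eq x
        simp only [Module.End.mul_apply] at this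
        rw [ys, ys, J.mul_comm (J.mul x x), ← this, J.mul_comm (y k) x]
      rw [h]
      exact J.commute_mul_sq_mul ih.1 (by rw [← ys]; exact ih.2)
  let A : Submodule ℝ V := Submodule.span ℝ (Set.range y)
  have hA : ∀ v ∈ A, J.mul x v ∈ A := by
    intro v hv
    induction hv using Submodule.span_induction with
    | mem v hv =>
      obtain ⟨k, rfl⟩ := hv
      rw [← ys]
      exact Submodule.subset_span ⟨_, rfl⟩
    | zero => simp
    | add u v _ _ hu hv => rw [map_add]; exact A.add_mem hu hv
    | smul a v _ hv => rw [map_smul]; exact A.smul_mem a hv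
  have hAcomm : ∀ v ∈ A, Commute (J.mul x) (J.mul v) := by
    intro v hv
    induction hv using Submodule.span_induction with
    | mem v hv => obtain ⟨k, rfl⟩ := hv; exact (hcomm k).1
    | zero => rw [map_zero]; exact Commute.zero_right _
    | add u v _ _ hu hv => rw [map_add]; exact hu.add_right hv
    | smul a v _ hv => rw [map_smul]; exact hv.smul_right a
  have hyc : ∀ k, J.mul c (y k) = y k := by
    intro k
    induction k with
    | zero => exact hc
    | succ k ih => rw [ys, hc.commute_of_one hx, ih]
  have hAc : ∀ v ∈ A, J.mul c v = v := by
    intro v hv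
    induction hv using Submodule.span_induction with
    | mem v hv => obtain ⟨k, rfl⟩ := hv; exact hyc k
    | zero => simp
    | add u v _ _ hu hv => rw [map_add, hu, hv]
    | smul a v _ hv => rw [map_smul, hv]
  have hc0 : c ≠ 0 := by
    rintro rfl
    exact hxc 0 (by rw [← hx]; simp)
  have hcA : c ∈ A := Submodule.subset_span ⟨0, rfl⟩
  have : Nontrivial A := ⟨⟨⟨c, hcA⟩, 0, fun h => hc0 (congrArg Subtype.val h)⟩⟩
  -- Associativity of `B` makes multiplication by `x` symmetric on `A`.
  obtain ⟨a, w, hw0, hw⟩ := exists_eigenvector_of_symmetric (W := A)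
    (B.compl₁₂ A.subtype A.subtype) (fun u v => hsymm u v)
    (fun u hu => hpos u (fun h => hu (Subtype.ext h))) ((J.mul x).restrict hA)
    (fun u v => by
      change B (J.mul x u) v = B u (J.mul x v)
      rw [J.mul_comm, hB])
  obtain ⟨w, hwA⟩ := w
  have hw0 : w ≠ 0 := fun h => hw0 (Subtype.ext h)
  have hw : J.mul x w = a • w := congrArg Subtype.val hw
  -- All of `A` acts on `w` by scalars, `w` included; hence `w ∘ w = μ w`, and `μ⁻¹ • w` is
  -- idempotent.
  have hmul : ∀ v ∈ A, ∃ μ : ℝ, J.mul v w = μ • w := by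
    intro v hv
    induction hv using Submodule.span_induction with
    | mem v hv =>
      obtain ⟨k, rfl⟩ := hv
      induction k with
      | zero => exact ⟨1, by rw [y0, hAc w hwA, one_smul]⟩
      | succ k ih =>
        obtain ⟨μ, hμ⟩ := ih
        refine ⟨μ * a, ?_⟩
        have := LinearMap.congr_fun (hAcomm w hwA).eq (y k)
        simp only [Module.End.mul_apply] at this
        rw [ys, J.mul_comm, ← this, J.mul_comm w, hμ, map_smul, hw, smul_smul]
    | zero => exact ⟨0, by simp⟩
    | add u v _ _ hu hv =>
      obtain ⟨μ, hμ⟩ := hu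
      obtain ⟨ν, hν⟩ := hv
      exact ⟨μ + ν, by rw [map_add, LinearMap.add_apply, hμ, hν, add_smul]⟩
    | smul b v _ hv =>
      obtain ⟨μ, hμ⟩ := hv
      exact ⟨b * μ, by rw [map_smul, LinearMap.smul_apply, hμ, smul_smul]⟩
  obtain ⟨μ, hμ⟩ := hmul w hwA
  have hμ0 : μ ≠ 0 := by
    rintro rfl
    have := hpos w hw0
    rw [← hBe, hμ] at this
    simp at this
  have hxd : J.mul x (μ⁻¹ • w) = a • μ⁻¹ • w := by rw [map_smul, hw, smul_comm]
  refine ⟨μ⁻¹ • w, ?_, smul_ne_zero (inv_ne_zero hμ0) hw0, ?_, ?_, a, hxd⟩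
  · simp only [IsIdempotent, map_smul, LinearMap.smul_apply, hμ]
    rw [smul_smul μ⁻¹ μ, inv_mul_cancel₀ hμ0, one_smul]
  · intro h
    rw [h, J.mul_comm, hx] at hxd
    exact hxc a hxd
  · rw [map_smul, hAc w hwA]

lemma IsPrimitiveIdempotent.eq_smul (hc : J.IsPrimitiveIdempotent c) {x : V}
    (hx : J.mul c x = x) : ∃ a : ℝ, x = a • c := by
  by_contra! h
  obtain ⟨d, hd, hd0, hdc, hcd, -⟩ := hc.1.exists_idempotent hx h
  exact hc.2 ⟨d, c - d, hd, hc.1.sub hd hcd, hdc, by simpa using hd0, by abel⟩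

/-- The spectral theorem in the Peirce `1`-space of an idempotent. -/
lemma IsIdempotent.exists_spectral (hc : J.IsIdempotent c) {x : V} (hx : J.mul c x = x) :
    ∃ (ι : Type) (_ : Fintype ι) (f : ι → V) (l : ι → ℝ),
      (∀ i, f i ≠ 0 ∧ J.IsPrimitiveIdempotent (f i)) ∧ (∀ i j, i ≠ j → J.mul (f i) (f j) = 0) ∧
        ∑ i, f i = c ∧ x = ∑ i, l i • f i := by
  induction hn : Module.finrank ℝ (LinearMap.eqLocus (J.mul c) LinearMap.id)
    using Nat.strong_induction_on generalizing c x with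
  | _ n ih =>
  have hc' : J.mul c c = c := hc
  by_cases hsplit : ∃ d, J.IsIdempotent d ∧ d ≠ 0 ∧ d ≠ c ∧ J.mul c d = d ∧
      ∃ a : ℝ, J.mul x d = a • d
  · obtain ⟨d, hd, hd0, hdc, hcd, a, hxd⟩ := hsplit
    have hd' : J.mul d d = d := hd
    -- The dimension drops because `c` is not in the Peirce `1`-space of `d'`.
    have key : ∀ d', J.IsIdempotent d' → d' ≠ c → J.mul c d' = d' →
        Module.finrank ℝ (LinearMap.eqLocus (J.mul d') LinearMap.id) < n := by
      intro d' h1 h2 h3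
      rw [← hn]
      refine Submodule.finrank_lt_finrank_of_lt (lt_of_le_of_ne ?_ ?_)
      · intro y hy
        exact h1.mul_eq_of_le h3 hy
      · intro h
        have : c ∈ LinearMap.eqLocus (J.mul d') LinearMap.id := by rw [h]; exact hc
        have : J.mul d' c = c := this
        rw [J.mul_comm, h3] at this
        exact h2 this
    have hcd' : J.mul c (c - d) = c - d := by rw [map_sub, hc', hcd]
    have hd2 := hc.sub hd hcd
    obtain ⟨ι₁, _, f₁, l₁, hp₁, ho₁, hs₁, hx₁⟩ :=
      ih _ (key d hd hdc hcd) hd (x := a • d) (by rw [map_smul, hd']) rfl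
    obtain ⟨ι₂, _, f₂, l₂, hp₂, ho₂, hs₂, hx₂⟩ :=
      ih _ (key (c - d) hd2 (by simpa using hd0) hcd') hd2 (x := x - a • d)
        (by simp only [map_sub, LinearMap.sub_apply, map_smul, hd', hcd, hx, J.mul_comm d x, hxd]
            module) rfl
    have hle : ∀ {ι : Type} [Fintype ι] {f : ι → V},
        (∀ i, f i ≠ 0 ∧ J.IsPrimitiveIdempotent (f i)) →
        (∀ i j, i ≠ j → J.mul (f i) (f j) = 0) → ∀ i, J.mul (∑ j, f j) (f i) = f i := by
      intro ι _ f hp ho i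
      rw [map_sum, LinearMap.sum_apply, Finset.sum_eq_single i]
      · exact (hp i).2.1
      · intro j _ hj
        exact ho j i hj
      · simp
    have hcross : ∀ i j, J.mul (f₁ i) (f₂ j) = 0 := by
      intro i j
      have h1 := hle hp₁ ho₁ i
      have h2 := hle hp₂ ho₂ j
      rw [hs₁] at h1
      rw [hs₂] at h2
      have h3 : J.mul (c - d) (f₁ i) = 0 :=
        hd.mul_eq_zero (by rw [map_sub, hd', J.mul_comm, hcd, sub_self]) h1
      exact hd2.mul_eq_zero h3 h2
    refine ⟨ι₁ ⊕ ι₂, inferInstance, Sum.elim f₁ f₂, Sum.elim l₁ l₂, ?_, ?_, ?_, ?_⟩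
    · rintro (i | i)
      · exact hp₁ i
      · exact hp₂ i
    · rintro (i | i) (j | j) hij
      · exact ho₁ i j (by simpa using hij)
      · exact hcross i j
      · simp only [Sum.elim_inl, Sum.elim_inr]
        rw [J.mul_comm]
        exact hcross j i
      · exact ho₂ i j (by simpa using hij)
    · simp [hs₁, hs₂]
    · simp [← hx₁, ← hx₂]
  · have hxa : ∃ a : ℝ, x = a • c := by
      by_contra! h
      exact hsplit (hc.exists_idempotent hx h)
    obtain ⟨a, rfl⟩ := hxa
    by_cases hc0 : c = 0
    · exact ⟨Empty, inferInstance, Empty.elim, Empty.elim, fun i => i.elim, fun i => i.elim,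
        by simp [hc0], by simp [hc0]⟩
    · refine ⟨Unit, inferInstance, fun _ => c, fun _ => a, fun _ => ⟨hc0, hc, ?_⟩,
        fun i j h => (h rfl).elim, by simp, by simp⟩
      -- Here `x = a • c`, so a decomposition `c = u + v` would make `u` a splitting idempotent.
      rintro ⟨u, v, hu, hv, huc, hvc, rfl⟩
      have hu' : J.mul u u = u := hu
      have hv' : J.mul v v = v := hv
      have huv : J.mul u v = 0 := by
        simp only [map_add, LinearMap.add_apply, hu', hv', J.mul_comm v u] at hc'
        have : (2 : ℝ) • J.mul u v = 0 := by linear_combination (norm := module) hc'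
        simpa using this
      refine hsplit ⟨u, hu, ?_, huc, ?_, a, ?_⟩
      · rintro rfl
        simp at hvc
      · rw [map_add, LinearMap.add_apply, hu', J.mul_comm v u, huv, add_zero]
      · rw [map_smul, LinearMap.smul_apply, map_add, LinearMap.add_apply, hu', J.mul_comm v u,
          huv, add_zero]

end Spectral

end EuclideanJordanAlgebra

/-! ### Frames, the rank and the trace form. -/

namespace EuclideanJordanAlgebra

variable {V : Type*} [AddCommGroup V] [Module ℝ V] (J : EuclideanJordanAlgebra V)

lemma isIdempotent_e : J.IsIdempotent J.e := J.mul_e _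

lemma e_mul (x : V) : J.mul J.e x = x := by rw [J.mul_comm, J.mul_e]

section Orthogonal

variable {J}
variable {ι : Type*} [Fintype ι] {f : ι → V}

lemma mul_sum_smul (hi : ∀ i, J.IsIdempotent (f i))
    (ho : ∀ i j, i ≠ j → J.mul (f i) (f j) = 0) (a b : ι → ℝ) :
    J.mul (∑ i, a i • f i) (∑ i, b i • f i) = ∑ i, (a i * b i) • f i := by
  rw [map_sum]
  refine Finset.sum_congr rfl fun i _ => ?_
  rw [map_sum, LinearMap.sum_apply, Finset.sum_eq_single i]
  · have h : J.mul (f i) (f i) = f i := hi i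
    rw [map_smul, map_smul, LinearMap.smul_apply, h, smul_smul, _root_.mul_comm]
  · intro j _ hj
    rw [map_smul, map_smul, LinearMap.smul_apply, ho j i hj, smul_zero, smul_zero]
  · simp

lemma pow_sum_smul (hi : ∀ i, J.IsIdempotent (f i))
    (ho : ∀ i j, i ≠ j → J.mul (f i) (f j) = 0) (hs : ∑ i, f i = J.e) (a : ι → ℝ) (k : ℕ) :
    J.pow (∑ i, a i • f i) k = ∑ i, (a i ^ k) • f i := by
  induction k with
  | zero => simp [pow, hs]
  | succ k ih => rw [pow, ih, mul_sum_smul hi ho]; simp only [pow_succ']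

lemma linearIndependent_of_orthogonal (hi : ∀ i, f i ≠ 0 ∧ J.IsIdempotent (f i))
    (ho : ∀ i j, i ≠ j → J.mul (f i) (f j) = 0) : LinearIndependent ℝ f := by
  classical
  rw [Fintype.linearIndependent_iff]
  intro g hg i
  have h := mul_sum_smul (fun i => (hi i).2) ho g (Pi.single i 1)
  rw [hg, map_zero, LinearMap.zero_apply, Finset.sum_eq_single i] at h
  · simpa [(hi i).1] using h.symm
  · intro j _ hj
    simp [hj]
  · simp

end Orthogonal

variable [FiniteDimensional ℝ V]

variable {J} in
/-- Non-orthogonal primitive idempotents have the same length for an associative form. -/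
lemma IsPrimitiveIdempotent.form_eq_zero_or {B : V →ₗ[ℝ] V →ₗ[ℝ] ℝ}
    (hB : ∀ x y z, B (J.mul x y) z = B x (J.mul y z)) (hsymm : ∀ x y, B x y = B y x)
    {c d : V} (hc : J.IsPrimitiveIdempotent c) (hd : J.IsPrimitiveIdempotent d) :
    B c d = 0 ∨ B c c = B d d := by
  have key : ∀ c d, J.IsPrimitiveIdempotent c → J.IsPrimitiveIdempotent d →
      (2 * B (J.mul c d) (J.mul c d) - B c d) * B c c = B c d * B c d := by
    intro c d hc hd
    -- Pairing this relation with `c` and with `d` and eliminating `μ` gives `key`; exchanging `c`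
    -- and `d` changes only the factor `B c c`.
    obtain ⟨μ, hμ⟩ := hc.eq_smul (hc.1.peirce d)
    have hc' : J.mul c c = c := hc.1
    have hd' : J.mul d d = d := hd.1
    have e0 : B (J.mul c d) c = B c d := by rw [J.mul_comm, hB, hc', hsymm]
    have e1 : B (J.mul c (J.mul c d)) c = B c d := by
      rw [J.mul_comm, hB, hc', e0]
    have e2 : B (J.mul c d) d = B c d := by rw [hB, hd']
    have e3 : B (J.mul c (J.mul c d)) d = B (J.mul c d) (J.mul c d) := by
      rw [J.mul_comm, hB]
    have h1 := congrArg (fun v => B v c) hμ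
    have h2 := congrArg (fun v => B v d) hμ
    simp only [map_sub, map_smul, LinearMap.sub_apply, LinearMap.smul_apply, smul_eq_mul,
      e0, e1, e2, e3] at h1 h2
    linear_combination B c c * h2 - B c d * h1
  have h1 := key c d hc hd
  have h2 := key d c hd hc
  rw [J.mul_comm d c, hsymm d c] at h2
  by_cases h : B c d = 0
  · exact Or.inl h
  · right
    have h3 : B c d * B c d ≠ 0 := mul_ne_zero h h
    have h4 : 2 * B (J.mul c d) (J.mul c d) - B c d ≠ 0 := by
      intro h0
      rw [h0, zero_mul] at h1
      exact h3 h1.symm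
    exact mul_left_cancel₀ h4 (h1.trans h2.symm)

/-- There is a linear functional with value `1` at all non-zero primitive idempotents. -/
lemma exists_linear_trace :
    ∃ τ : V →ₗ[ℝ] ℝ, ∀ c, c ≠ 0 → J.IsPrimitiveIdempotent c → τ c = 1 := by
  classical
  obtain ⟨B, hB, hpos, hsymm, hBe⟩ := J.exists_symm_form
  let S : Set V := {c | c ≠ 0 ∧ J.IsPrimitiveIdempotent c}
  let π : (S →₀ ℝ) →ₗ[ℝ] V := Finsupp.linearCombination ℝ Subtype.val
  let F : (S →₀ ℝ) →ₗ[ℝ] ℝ := Finsupp.linearCombination ℝ fun _ => (1 : ℝ)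
  have hπ : LinearMap.range π = ⊤ := by
    rw [Finsupp.range_linearCombination, Subtype.range_coe, eq_top_iff]
    intro x _
    obtain ⟨ι, _, f, l, hp, -, -, rfl⟩ := J.isIdempotent_e.exists_spectral (J.e_mul x)
    exact Submodule.sum_mem _ fun i _ => Submodule.smul_mem _ _ (Submodule.subset_span (hp i))
  -- The coefficient sum must vanish on every linear relation. Grouping a relation by the length `B
  -- c c` gives mutually orthogonal partial sums, each therefore zero; pairing one with `e` gives
  -- its length times its coefficient sum.
  have hker : ∀ f, π f = 0 → F f = 0 := by
    intro f hf
    let n : S → ℝ := fun c => B c c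
    let v : ℝ → V := fun b => ∑ c ∈ f.support with n c = b, f c • (c : V)
    have htot : ∑ c ∈ f.support, f c • (c : V) = 0 := hf
    have hv : ∀ b, v b = 0 := by
      intro b
      by_contra h
      refine (hpos _ h).ne' ?_
      have h1 : B (v b) (∑ c ∈ f.support, f c • (c : V)) = B (v b) (v b) := by
        rw [← Finset.sum_filter_add_sum_filter_not f.support (fun c => n c = b), map_add]
        have : B (v b) (∑ c ∈ f.support with ¬ n c = b, f c • (c : V)) = 0 := by
          simp only [v, map_sum, LinearMap.sum_apply]
          refine Finset.sum_eq_zero fun c hc => Finset.sum_eq_zero fun d hd => ?_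
          simp only [Finset.mem_filter] at hc hd
          rcases d.2.2.form_eq_zero_or hB hsymm c.2.2 with h0 | h0
          · simp [h0]
          · exact absurd (h0.symm.trans hd.2) hc.2
        rw [this, add_zero]
      rw [← h1, htot, map_zero]
    have hF : F f = ∑ c ∈ f.support, f c := by
      simp [F, Finsupp.linearCombination_apply, Finsupp.sum]
    rw [hF, ← Finset.sum_fiberwise_of_maps_to
      (fun c hc => Finset.mem_image_of_mem n hc) (fun c => f c)]
    refine Finset.sum_eq_zero fun b hb => ?_
    obtain ⟨c₀, -, rfl⟩ := Finset.mem_image.mp hb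
    have h1 : B (v (n c₀)) J.e = n c₀ * ∑ c ∈ f.support with n c = n c₀, f c := by
      simp only [v, map_sum, LinearMap.sum_apply, map_smul, LinearMap.smul_apply, smul_eq_mul,
        Finset.mul_sum]
      refine Finset.sum_congr rfl fun c hc => ?_
      have h2 : J.mul (c : V) c = c := c.2.2.1
      have h3 := hBe c c
      rw [h2] at h3
      rw [h3, ← (Finset.mem_filter.mp hc).2, _root_.mul_comm]
    rw [hv, map_zero, LinearMap.zero_apply] at h1
    exact (mul_eq_zero.mp h1.symm).resolve_left (hpos _ c₀.2.1).ne'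
  obtain ⟨g, hg⟩ := π.exists_rightInverse_of_surjective hπ
  refine ⟨F ∘ₗ g, fun c hc0 hc => ?_⟩
  have h := hker (g c - Finsupp.single ⟨c, hc0, hc⟩ 1) (by
    have := LinearMap.congr_fun hg c
    simp only [LinearMap.comp_apply, LinearMap.id_apply] at this
    rw [map_sub, this]
    simp [π])
  rw [map_sub, sub_eq_zero] at h
  rw [LinearMap.comp_apply, h]
  simp [F]

section Rank

variable {J} {ι : Type*} [Fintype ι] {f : ι → V}

/-- The rank is the number of elements of a complete system of primitive idempotents. -/
lemma card_eq_rank (hp : ∀ i, f i ≠ 0 ∧ J.IsPrimitiveIdempotent (f i))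
    (ho : ∀ i j, i ≠ j → J.mul (f i) (f j) = 0) (hs : ∑ i, f i = J.e) :
    Fintype.card ι = J.rank := by
  obtain ⟨τ, hτ⟩ := J.exists_linear_trace
  have hcard : ∀ {κ : Type _} [Fintype κ] {g : κ → V},
      (∀ i, g i ≠ 0 ∧ J.IsPrimitiveIdempotent (g i)) → ∑ i, g i = J.e →
        (Fintype.card κ : ℝ) = τ J.e := by
    intro κ _ g hg hgs
    rw [← hgs, map_sum, Finset.sum_congr rfl fun i _ => hτ _ (hg i).1 (hg i).2]
    simp
  refine (IsLeast.csInf_eq ⟨?_, ?_⟩).symm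
  · intro x hx
    obtain ⟨κ, _, g, l, hg, hgo, hgs, hxl⟩ := J.isIdempotent_e.exists_spectral (J.e_mul x)
    -- Both cardinalities equal `τ J.e`, so the powers of every `x` lie in a span of `card ι`
    -- vectors.
    have hκ : Fintype.card κ = Fintype.card ι := by
      have h1 : (Fintype.card κ : ℝ) = τ J.e := by
        rw [← hgs, map_sum, Finset.sum_congr rfl fun i _ => hτ _ (hg i).1 (hg i).2]
        simp
      exact_mod_cast h1.trans (hcard hp hs).symm
    have hmem : ∀ i : Fin (Fintype.card ι + 1),
        J.pow x i ∈ Submodule.span ℝ (Set.range g) := by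
      intro i
      rw [hxl, pow_sum_smul (fun i => (hg i).2.1) hgo hgs]
      exact Submodule.sum_mem _ fun j _ => Submodule.smul_mem _ _ (Submodule.subset_span ⟨j, rfl⟩)
    have h1 : LinearIndependent ℝ
        (fun i : Fin (Fintype.card ι + 1) =>
          (⟨J.pow x i, hmem i⟩ : Submodule.span ℝ (Set.range g))) :=
      LinearIndependent.of_comp (Submodule.subtype _) hx
    have h2 := h1.fintype_card_le_finrank
    have h3 := finrank_range_le_card (R := ℝ) g
    rw [Set.finrank, hκ] at h3
    rw [Fintype.card_fin] at h2
    omega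
  · intro r hr
    by_contra! hlt
    -- Distinct eigenvalues: a relation among `e, x, …, x ^ r` is a polynomial of degree at most `r`
    -- with `card ι > r` roots.
    let a : ι → ℝ := fun i => (Fintype.equivFin ι i : ℕ)
    have ha : Function.Injective a := fun i j h => by
      simpa [a, Fin.val_inj] using h
    refine hr (∑ i, a i • f i) ?_
    rw [Fintype.linearIndependent_iff]
    intro g hg
    have hli := Fintype.linearIndependent_iff.mp
      (linearIndependent_of_orthogonal (fun i => ⟨(hp i).1, (hp i).2.1⟩) ho)
    simp only [pow_sum_smul (fun i => (hp i).2.1) ho hs, Finset.smul_sum, smul_smul] at hg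
    rw [Finset.sum_comm] at hg
    simp only [← Finset.sum_smul] at hg
    have h0 := hli _ hg
    let p : Polynomial ℝ := ∑ k : Fin (r + 1), Polynomial.monomial k (g k)
    have hdeg : p.natDegree ≤ r :=
      Polynomial.natDegree_sum_le_of_forall_le _ _ fun k _ =>
        (Polynomial.natDegree_monomial_le _).trans (by omega)
    have hp0 : p = 0 := by
      refine Polynomial.eq_zero_of_natDegree_lt_card_of_eval_eq_zero p ha ?_ (by omega)
      intro i
      rw [← h0 i]
      simp [p, Polynomial.eval_finsetSum]
    intro k
    have h4 := congrArg (fun q => q.coeff k) hp0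
    simpa [p, Polynomial.finsetSum_coeff, Polynomial.coeff_monomial, Fin.val_inj] using h4

end Rank

/-- The spectral theorem at `e`, with `card_eq_rank` supplying the index type `Fin J.rank`, makes
the chosen eigenvalues genuine. -/
lemma isEigenvalueVector_eigenvalues (x : V) : J.IsEigenvalueVector x (J.eigenvalues x) := by
  refine Classical.epsilon_spec (p := J.IsEigenvalueVector x) ?_
  obtain ⟨ι, _, f, l, hp, ho, hs, hx⟩ := J.isIdempotent_e.exists_spectral (J.e_mul x)
  let φ : Fin J.rank ≃ ι := (Fintype.equivFinOfCardEq (card_eq_rank hp ho hs)).symm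
  refine ⟨l ∘ φ, f ∘ φ, ⟨fun i => hp _, fun i j h => ho _ _ (φ.injective.ne h), ?_⟩, ?_⟩
  · rw [← hs]
    exact φ.sum_comp f
  · rw [hx]
    exact (φ.sum_comp fun i => l i • f i).symm

/-- The trace is linear, and the trace form is positive definite; on squares it is bounded by the
square of the trace. -/
lemma exists_trace_form : ∃ (τ : V →ₗ[ℝ] ℝ) (B : V →ₗ[ℝ] V →ₗ[ℝ] ℝ),
    (∀ x, J.trace x = τ x) ∧ (∀ x y, J.ip x y = B x y) ∧ (∀ x y, B x y = B y x) ∧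
      (∀ x, x ≠ 0 → 0 < B x x) ∧
      ∀ y, B (J.mul y y) (J.mul y y) ≤ τ (J.mul y y) ^ 2 := by
  obtain ⟨τ, hτ⟩ := J.exists_linear_trace
  have hsum : ∀ {c : Fin J.rank → V}, J.IsJordanFrame c → ∀ l : Fin J.rank → ℝ,
      τ (∑ i, l i • c i) = ∑ i, l i := by
    intro c hc l
    rw [map_sum]
    refine Finset.sum_congr rfl fun i _ => ?_
    rw [map_smul, hτ _ (hc.1 i).1 (hc.1 i).2, smul_eq_mul, mul_one]
  have htr : ∀ x, J.trace x = τ x := by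
    intro x
    obtain ⟨c, hc, hx⟩ := J.isEigenvalueVector_eigenvalues x
    conv_rhs => rw [hx]
    rw [hsum hc, trace]
  refine ⟨τ, J.mul.compr₂ τ, htr, fun x y => htr _, fun x y => ?_, fun x hx0 => ?_, fun y => ?_⟩
  · simp only [LinearMap.compr₂_apply, J.mul_comm x y]
  · obtain ⟨c, hc, hx⟩ := J.isEigenvalueVector_eigenvalues x
    generalize J.eigenvalues x = l at hx
    subst hx
    rw [LinearMap.compr₂_apply, mul_sum_smul (fun i => (hc.1 i).2.1) hc.2.1, hsum hc]
    refine lt_of_le_of_ne (Finset.sum_nonneg fun i _ => mul_self_nonneg _) fun h => hx0 ?_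
    have h1 := (Finset.sum_eq_zero_iff_of_nonneg fun i _ => mul_self_nonneg (l i)).mp h.symm
    exact Finset.sum_eq_zero fun i hi => by rw [mul_self_eq_zero.mp (h1 i hi), zero_smul]
  · obtain ⟨c, hc, hy⟩ := J.isEigenvalueVector_eigenvalues y
    generalize J.eigenvalues y = l at hy
    subst hy
    have hi := fun i => (hc.1 i).2.1
    rw [LinearMap.compr₂_apply, mul_sum_smul hi hc.2.1, mul_sum_smul hi hc.2.1, hsum hc, hsum hc]
    simpa only [pow_two] using
      Finset.sum_sq_le_sq_sum_of_nonneg (s := Finset.univ) (f := fun i => l i * l i)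
        fun i _ => mul_self_nonneg (l i)

end EuclideanJordanAlgebra

/-! ### The perceptron estimate, for an arbitrary form. -/

/-- Along a run of the perceptron scheme `t ‖P z_t‖² ≤ 1`, as long as it has not halted. -/
lemma IsPerceptronRun.bound {V : Type*} [AddCommGroup V] [Module ℝ V] {B : V →ₗ[ℝ] V →ₗ[ℝ] ℝ}
    (hs : ∀ x y, B x y = B y x) (hp : ∀ x, x ≠ 0 → 0 < B x x) {f : V →ₗ[ℝ] ℝ} {D : Set V}
    (hD : ∀ u ∈ D, B u u ≤ 1 ∧ f u = 1) {L : Submodule ℝ V} {P : V → V}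
    (hP : ∀ x, P x ∈ L ∧ ∀ y ∈ L, B (x - P x) y = 0) {Stop : V → Prop} {z : ℕ → V}
    (hz : IsPerceptronRun D (fun x y => B x y) P Stop z) (t : ℕ) (h : ∀ s < t, ¬ Stop (z s)) :
    t * B (P (z t)) (P (z t)) ≤ 1 ∧ f (z t) = 1 := by
  have hnn : ∀ x, 0 ≤ B x x := fun x => by
    by_cases hx : x = 0
    · simp [hx]
    · exact (hp x hx).le
  have hPB : ∀ x y, B (P x) (P y) = B x (P y) := fun x y => by
    have := (hP x).2 _ (hP y).1
    rw [map_sub, LinearMap.sub_apply] at this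
    linarith
  -- The defect of linearity lies in `L` and is orthogonal to `L`.
  have hPlin : ∀ (a b : ℝ) (x y : V), P (a • x + b • y) = a • P x + b • P y := by
    intro a b x y
    have hmem : P (a • x + b • y) - (a • P x + b • P y) ∈ L :=
      L.sub_mem (hP _).1 (L.add_mem (L.smul_mem _ (hP _).1) (L.smul_mem _ (hP _).1))
    by_contra hne
    refine (hp _ (sub_ne_zero.mpr hne)).ne' ?_
    have h1 := (hP (a • x + b • y)).2 _ hmem
    have h2 := (hP x).2 _ hmem
    have h3 := (hP y).2 _ hmem
    set d := P (a • x + b • y) - (a • P x + b • P y) with hd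
    have h4 : d = a • (x - P x) + b • (y - P y) - (a • x + b • y - P (a • x + b • y)) := by
      rw [hd]; module
    have h5 := congrArg (fun v => B v d) h4
    simp only [LinearMap.map_sub₂, LinearMap.map_add₂, LinearMap.map_smul₂, smul_eq_mul]
      at h1 h2 h3 h5
    linear_combination h5 + a * h2 + b * h3 - h1
  induction t with
  -- The factor `t = 0` makes any bound on `P z_0` unnecessary.
  | zero => exact ⟨by simp, (hD _ hz.1).2⟩
  | succ t ih =>
    obtain ⟨ih1, ih2⟩ := ih fun s hst => h s (by omega)
    obtain ⟨u, hu, hu1, hu2⟩ := hz.2 t fun s hst => h s (by omega)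
    have ht : (0 : ℝ) < t + 1 := by positivity
    have ht0 : (0 : ℝ) ≤ t := t.cast_nonneg
    constructor
    · have e1 : B (P u) (P (z t)) = B u (P (z t)) := hPB _ _
      have e2 : B (P u) (P u) ≤ 1 := by
        have h1 := hnn (u - P u)
        have h2 := hPB u u
        have h3 := (hD u hu).1
        simp only [map_sub, LinearMap.sub_apply] at h1
        rw [hs (P u) u] at h1
        linarith
      have e3 : ((t : ℝ) + 1) * B (P (z (t + 1))) (P (z (t + 1))) * (t + 1) =
          t * (t * B (P (z t)) (P (z t))) + 2 * t * B (P u) (P (z t)) + B (P u) (P u) := by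
        rw [hu2, hPlin]
        simp only [map_add, map_smul, LinearMap.add_apply, LinearMap.smul_apply, smul_eq_mul]
        rw [hs (P (z t)) (P u)]
        field_simp
        ring
      have e4 : (t : ℝ) * (t * B (P (z t)) (P (z t))) ≤ t * 1 :=
        mul_le_mul_of_nonneg_left ih1 ht0
      have e5 : 2 * (t : ℝ) * B (P u) (P (z t)) ≤ 0 :=
        mul_nonpos_of_nonneg_of_nonpos (by positivity) (e1 ▸ hu1)
      push_cast
      refine le_of_mul_le_mul_right ?_ ht
      rw [e3]
      linarith
    · rw [hu2, map_add, map_smul, map_smul, ih2, (hD u hu).2, smul_eq_mul, smul_eq_mul]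
      field_simp

lemma one_le_card_mul_norm {n : ℕ} {l : Fin n → ℝ} (h : ∑ i, l i = 1) : 1 ≤ n * ‖l‖ := by
  calc (1 : ℝ) = ∑ i, l i := h.symm
    _ ≤ ∑ _i : Fin n, ‖l‖ :=
      Finset.sum_le_sum fun i _ => (Real.le_norm_self _).trans (norm_le_pi_norm l i)
    _ = n * ‖l‖ := by simp

/-! ### The symmetric cone and the first bound. -/

namespace EuclideanJordanAlgebra

variable {V : Type*} [AddCommGroup V] [Module ℝ V] [TopologicalSpace V] [ContinuousSMul ℝ V]
  (J : EuclideanJordanAlgebra V)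

open scoped Pointwise in
lemma smul_mem_closure_Omega {q : V} (hq : q ∈ closure J.Omega) {s : ℝ} (hs : 0 ≤ s) :
    s • q ∈ closure J.Omega := by
  have hpos : ∀ a : ℝ, 0 < a → a • q ∈ closure J.Omega := by
    intro a ha
    refine map_mem_closure (continuous_const_smul a) hq fun x hx => ?_
    have h1 : a • x ∈ interior (a • {x : V | ∃ y : V, x = J.mul y y}) := by
      rw [interior_smul₀ ha.ne']
      exact Set.smul_mem_smul_set hx
    refine interior_mono ?_ h1
    rintro _ ⟨_, ⟨y, rfl⟩, rfl⟩
    refine ⟨√a • y, ?_⟩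
    simp [smul_smul, Real.mul_self_sqrt ha.le]
  -- The scalar `0` is reached as a limit of positive ones.
  have h2 : s ∈ closure (Set.Ioi (0 : ℝ)) := by rwa [closure_Ioi]
  have h3 := map_mem_closure (f := fun a : ℝ => a • q) (by fun_prop) h2 hpos
  rwa [closure_closure] at h3

variable [FiniteDimensional ℝ V] [IsTopologicalAddGroup V] [T2Space V]

/-- Passing to the nearest point of the cone does not increase the Frobenius norm. -/
lemma frobNorm_posPart_le (hne : (closure J.Omega).Nonempty) (v : V) :
    J.frobNorm (J.posPart v) ≤ J.frobNorm v := by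
  obtain ⟨τ, B, -, hip, hs, hp, -⟩ := J.exists_trace_form
  obtain ⟨n, Φ, hΦ⟩ := exists_equiv_euclideanSpace B hs hp
  have hnorm : ∀ x, J.frobNorm x = ‖Φ x‖ := by
    intro x
    rw [frobNorm, hip, hΦ, real_inner_self_eq_norm_sq, Real.sqrt_sq (norm_nonneg _)]
  let Ψ := Φ.toContinuousLinearEquiv
  have hex : ∃ p, p ∈ closure J.Omega ∧
      ∀ q ∈ closure J.Omega, J.frobNorm (v - p) ≤ J.frobNorm (v - q) := by
    have hcl : IsClosed (Ψ.symm ⁻¹' closure J.Omega) := isClosed_closure.preimage Ψ.symm.continuous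
    have hne' : (Ψ.symm ⁻¹' closure J.Omega).Nonempty := by
      obtain ⟨q, hq⟩ := hne
      exact ⟨Ψ q, by simpa using hq⟩
    obtain ⟨w, hw, hwd⟩ := hcl.exists_infDist_eq_dist hne' (Ψ v)
    refine ⟨Ψ.symm w, hw, fun q hq => ?_⟩
    have h1 := Metric.infDist_le_dist_of_mem (x := Ψ v)
      (show Ψ q ∈ Ψ.symm ⁻¹' closure J.Omega by simpa using hq)
    rw [hwd, dist_eq_norm, dist_eq_norm] at h1
    rw [hnorm, hnorm, map_sub, map_sub]
    have h2 : Φ (Ψ.symm w) = w := Φ.apply_symm_apply w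
    rw [h2]
    exact h1
  have hspec : J.posPart v ∈ closure J.Omega ∧
      ∀ q ∈ closure J.Omega, J.frobNorm (v - J.posPart v) ≤ J.frobNorm (v - q) :=
    @Classical.epsilon_spec _ (fun p => p ∈ closure J.Omega ∧
      ∀ q ∈ closure J.Omega, J.frobNorm (v - p) ≤ J.frobNorm (v - q)) hex
  generalize J.posPart v = p at hspec
  obtain ⟨hpm, hmin⟩ := hspec
  have hnn : ∀ x, 0 ≤ B x x := fun x => by
    rw [hΦ]; exact real_inner_self_nonneg
  -- Only competitors `s • p` on the ray through `p` are needed, so convexity of the cone plays no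
  -- role. Taking `s = 0` and the minimizer `s = B v p / B p p` forces `B v p = B p p`, that is `v -
  -- p ⟂ p`, and Pythagoras concludes.
  have hquad : ∀ s : ℝ, 0 ≤ s → B p p - 2 * B v p ≤ s * s * B p p - 2 * s * B v p := by
    intro s hs0
    have h1 := hmin _ (J.smul_mem_closure_Omega hpm hs0)
    rw [frobNorm, frobNorm, hip, hip] at h1
    have h2 := (Real.sqrt_le_sqrt_iff (hnn _)).mp h1
    simp only [map_sub, map_smul, LinearMap.sub_apply, LinearMap.smul_apply, smul_eq_mul,
      hs p v] at h2
    linarith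
  rw [frobNorm, frobNorm, hip, hip]
  refine Real.sqrt_le_sqrt ?_
  rcases (hnn p).eq_or_lt with h0 | h0
  · rw [← h0]
    exact hnn v
  · have h1 := hquad 0 le_rfl
    have h2 := hquad (B v p / B p p) (div_nonneg (by linarith) h0.le)
    have h3 : B v p / B p p * (B v p / B p p) * B p p - 2 * (B v p / B p p) * B v p =
        -(B v p * B v p / B p p) := by
      field_simp
      ring
    rw [h3] at h2
    have h4 : B v p * B v p / B p p * B p p = B v p * B v p := div_mul_cancel₀ _ h0.ne'
    have h5 : (B v p - B p p) * (B v p - B p p) ≤ 0 := by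
      have := mul_le_mul_of_nonneg_right h2 h0.le
      rw [neg_mul, h4] at this
      linarith
    have h6 : B v p = B p p :=
      sub_eq_zero.mp (mul_self_eq_zero.mp (le_antisymm h5 (mul_self_nonneg _)))
    have h7 := hnn (v - p)
    simp only [map_sub, LinearMap.sub_apply, hs p v] at h7
    linarith

theorem exists_stop_le {L : Submodule ℝ V} {P : V → V} (hP : J.IsOrthogonalProjection L P)
    {z : ℕ → V} (hz : IsPerceptronRun J.spectraplex J.ip P (J.Stop P) z) :
    ∃ t : ℕ, t ≤ 16 * J.rank ^ 4 ∧ J.Stop P (z t) := by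
  by_contra! hno
  have hne : (closure J.Omega).Nonempty := ⟨_, hz.1.1⟩
  obtain ⟨τ, B, htr, hip, hs, hp, hsq⟩ := J.exists_trace_form
  obtain ⟨n, Φ, hΦ⟩ := exists_equiv_euclideanSpace B hs hp
  have hD : ∀ u ∈ J.spectraplex, B u u ≤ 1 ∧ τ u = 1 := by
    rintro u ⟨hu, hu1⟩
    have hτu : τ u = 1 := by rw [← htr, ← hu1, ip, J.e_mul]
    -- The inequality holds on squares and is closed, so it extends to the closure of `Ω`.
    have hcl : IsClosed {x : V | B x x ≤ τ x ^ 2} := by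
      have h1 : Continuous Φ := Φ.toContinuousLinearEquiv.continuous
      have h2 : Continuous τ := τ.continuous_of_finiteDimensional
      simp only [hΦ]
      exact isClosed_le (by fun_prop) (by fun_prop)
    have hsub : J.Omega ⊆ {x : V | B x x ≤ τ x ^ 2} := by
      intro x hx
      obtain ⟨y, rfl⟩ := interior_subset hx
      exact hsq y
    have h3 : B u u ≤ τ u ^ 2 := closure_minimal hsub hcl hu
    rw [hτu, one_pow] at h3
    exact ⟨h3, hτu⟩
  have hip' : J.ip = fun x y => B x y := by
    funext x y
    exact hip x y
  rw [hip'] at hz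
  obtain ⟨hb, hτz⟩ := hz.bound hs hp hD (fun x => ⟨(hP x).1, fun y hy => by
    rw [← hip]; exact (hP x).2 y hy⟩) (16 * J.rank ^ 4) (fun s hs => hno s hs.le)
  -- The bound at `T` needs non-halting only before `T`; non-halting at `T` itself then gives the
  -- contradiction.
  set T := 16 * J.rank ^ 4 with hT
  have hns := hno T le_rfl
  rw [Stop, not_or, not_le] at hns
  have hl : 1 ≤ (J.rank : ℝ) * J.opNorm (z T) :=
    one_le_card_mul_norm (by rw [← hτz, ← htr, trace])
  have hr : (0 : ℝ) < J.rank := by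
    rcases J.rank.cast_nonneg.eq_or_lt (α := ℝ) with h | h
    · rw [← h] at hl
      norm_num at hl
    · exact h
  have h1 := hns.2.trans_le (J.frobNorm_posPart_le hne _)
  have h2 : 1 < 4 * (J.rank : ℝ) ^ 2 * J.frobNorm (P (z T)) := by
    calc (1 : ℝ) ≤ J.rank * J.opNorm (z T) := hl
      _ = 4 * (J.rank : ℝ) ^ 2 * (1 / (4 * (J.rank : ℝ)) * J.opNorm (z T)) := by
        field_simp
      _ < _ := mul_lt_mul_of_pos_left h1 (by positivity)
  have h3 : J.frobNorm (P (z T)) ^ 2 = B (P (z T)) (P (z T)) := by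
    rw [frobNorm, hip, Real.sq_sqrt]
    rw [hΦ]
    exact real_inner_self_nonneg
  have h4 : 1 < (4 * (J.rank : ℝ) ^ 2 * J.frobNorm (P (z T))) ^ 2 := one_lt_pow₀ h2 two_ne_zero
  rw [mul_pow, h3] at h4
  rw [hT] at hb h4
  push_cast at hb
  linarith

end EuclideanJordanAlgebra

/-! ### The non-negative orthant. -/

lemma norm_orthantPosPart_le {n : ℕ} (v : EuclideanSpace ℝ (Fin n)) :
    ‖orthantPosPart v‖ ≤ ‖v‖ := by
  rw [EuclideanSpace.norm_eq, EuclideanSpace.norm_eq]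
  refine Real.sqrt_le_sqrt (Finset.sum_le_sum fun i _ => ?_)
  refine pow_le_pow_left₀ (norm_nonneg _) ?_ 2
  simp only [orthantPosPart, Real.norm_eq_abs]
  exact abs_max_le_max_abs_abs.trans (by simp)

theorem exists_orthantStop_le {n : ℕ} {L : Submodule ℝ (EuclideanSpace ℝ (Fin n))}
    {z : ℕ → EuclideanSpace ℝ (Fin n)}
    (hz : IsPerceptronRun (orthantSpectraplex n) (fun x y => inner ℝ x y)
      (fun x => L.starProjection x) (OrthantStop fun x => L.starProjection x) z) :
    ∃ t : ℕ, t ≤ 9 * n ^ 3 ∧ OrthantStop (fun x => L.starProjection x) (z t) := by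
  by_contra! hno
  let f : EuclideanSpace ℝ (Fin n) →ₗ[ℝ] ℝ := ∑ i, (EuclideanSpace.proj i).toLinearMap
  have hf : ∀ x, f x = ∑ i, x i := fun x => by simp [f]
  have hD : ∀ u ∈ orthantSpectraplex n, innerₗ _ u u ≤ 1 ∧ f u = 1 := by
    rintro u ⟨hu, hu1⟩
    refine ⟨?_, by rw [hf, hu1]⟩
    have h := Finset.sum_sq_le_sq_sum_of_nonneg (s := Finset.univ) (f := fun i => u i)
      fun i _ => hu i
    rw [hu1, one_pow] at h
    rw [innerₗ_apply_apply, real_inner_self_eq_norm_sq, EuclideanSpace.norm_sq_eq]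
    simpa using h
  obtain ⟨hb, hfz⟩ := IsPerceptronRun.bound (B := innerₗ _) (f := f) (L := L)
    (fun x y => real_inner_comm _ _) (fun x hx => real_inner_self_pos.mpr hx) hD
    (fun x => ⟨L.starProjection_apply_mem x,
      fun y hy => L.starProjection_inner_eq_zero x y hy⟩) hz (9 * n ^ 3)
    (fun s hs => hno s hs.le)
  set T := 9 * n ^ 3 with hT
  have hns := hno T le_rfl
  rw [OrthantStop, not_or, not_le] at hns
  rw [hf] at hfz
  have hl : 1 ≤ (n : ℝ) * ‖WithLp.ofLp (z T)‖ := one_le_card_mul_norm hfz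
  have hn : (0 : ℝ) < n := by
    rcases n.cast_nonneg.eq_or_lt (α := ℝ) with h | h
    · rw [← h] at hl
      norm_num at hl
    · exact h
  have h1 := hns.2.trans_le (norm_orthantPosPart_le _)
  -- Squaring gives `1 < 9 n³ ‖P z_T‖²`, against `T ‖P z_T‖² ≤ 1`.
  have h2 : 1 < 3 * √(n : ℝ) * n * ‖L.starProjection (z T)‖ := by
    calc (1 : ℝ) ≤ n * ‖WithLp.ofLp (z T)‖ := hl
      _ = 3 * √(n : ℝ) * n * (1 / (3 * √(n : ℝ)) * ‖WithLp.ofLp (z T)‖) := by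
        field_simp
      _ < _ := mul_lt_mul_of_pos_left h1 (by positivity)
  have h4 := one_lt_pow₀ h2 two_ne_zero
  rw [innerₗ_apply_apply, real_inner_self_eq_norm_sq] at hb
  rw [mul_pow, mul_pow, mul_pow, Real.sq_sqrt hn.le] at h4
  rw [hT] at hb h4
  push_cast at hb
  linarith

theorem mainTheorem8 :
    (∀ (V : Type*) [AddCommGroup V] [Module ℝ V] [FiniteDimensional ℝ V]
        [TopologicalSpace V] [IsTopologicalAddGroup V] [ContinuousSMul ℝ V] [T2Space V]
        (J : EuclideanJordanAlgebra V) (L : Submodule ℝ V) (P : V → V),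
        J.IsOrthogonalProjection L P →
        ∀ z : ℕ → V, IsPerceptronRun J.spectraplex J.ip P (J.Stop P) z →
          ∃ t : ℕ, t ≤ 16 * J.rank ^ 4 ∧ J.Stop P (z t)) ∧
    (∀ (n : ℕ) (L : Submodule ℝ (EuclideanSpace ℝ (Fin n))) (z : ℕ → EuclideanSpace ℝ (Fin n)),
        IsPerceptronRun (orthantSpectraplex n) (fun x y => inner ℝ x y)
          (fun x => L.starProjection x) (OrthantStop fun x => L.starProjection x) z →
          ∃ t : ℕ, t ≤ 9 * n ^ 3 ∧ OrthantStop (fun x => L.starProjection x) (z t)) := by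
  refine ⟨?_, ?_⟩
  · intro V _ _ _ _ _ _ _ J L P hP z hz
    exact J.exists_stop_le hP hz
  · intro n L z hz
    exact exists_orthantStop_le hz
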